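/- Let $n \ge 5$ and let $G = K_{2,n-2}$ be the complete bipartite graph with adjacency matrix $A$ and degree matrix $D$; let $u,v$ be the two vertices of the part of size $2$, in either order. For $k\in\mathbb{R}$ let $L_k = A + kD$. The walk generated by a real symmetric matrix $M$ is the family of unitary matrices $U_M(t) = e^{itM}$, i.e. the evolution $e^{-itH}$ with Hamiltonian $H=-M$; its transfer fidelity between $u$ and $v$ is $F_M(u,v) = \sup_{t>0} |U_M(t)_{u,v}|$. The cospectrality $\operatorname{co}(u,v)\in\mathbb{N}\cup\{\infty\}$ is the largest $m$ such that for every $l\le m$ the number of closed walks of length $l$ starting at $u$ equals the number of those starting at $v$ ($\infty$ if the numbers agree for all $l$). Write $E_x = e_xe_x^{\top}$. Then: 1. $u$ and $v$ have degree $n-2$, and every other vertex has degree $2$. 2. There is an automorphism $\sigma$ of $G$ with $\sigma^2 = \mathrm{id}$ and $\sigma(v) = u$, and $\operatorname{co}(u,v)=\infty$. 3. For every $k\in\mathbb{R}$, the walks generated by $L_k$ and by $A + Q(E_u+E_v)$ with $Q = k(n-4)$ agree up to a global phase: for every $t\in\mathbb{R}$ there is $c\in\mathbb{C}$ with $|c|=1$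 and $U_{L_k}(t) = c\,U_{A+Q(E_u+E_v)}(t)$. 4. For all $k\in\mathbb{R}$ and $\varepsilon>0$, $$|k| > 16\,\frac{(n-2)^{3/2}}{\sqrt{\varepsilon}\,(n-4)} \quad\Longrightarrow\quad F_{L_k}(u,v) \ge 1-\varepsilon .$$ -/

import Mathlib

section QuantumWalk

instance completeBipartiteGraph_decidableAdj (V W : Type*) :
    DecidableRel (completeBipartiteGraph V W).Adj :=
  fun v w => inferInstanceAs
    (Decidable (v.isLeft = true ∧ w.isRight = true ∨ v.isRight = true ∧ w.isLeft = true))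

/-- The generalized Laplacian `L_k = A + k D` of a finite graph. -/
noncomputable def generalizedLaplacian {V : Type*} [Fintype V] [DecidableEq V]
    (G : SimpleGraph V) [DecidableRel G.Adj] (k : ℝ) : Matrix V V ℝ :=
  G.adjMatrix ℝ + k • G.degMatrix ℝ

/-- The projection `E_x = e_x e_xᵀ` onto the basis vector of the vertex `x`. -/
def vertexProjection {V : Type*} [DecidableEq V] (x : V) : Matrix V V ℝ :=
  Matrix.vecMulVec (Pi.single x 1) (Pi.single x 1)

/-- The time evolution operator `U(t) = exp (-i t H)` of a real Hamiltonian `H`. -/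
noncomputable def timeEvolution {V : Type*} [Fintype V] [DecidableEq V]
    (H : Matrix V V ℝ) (t : ℝ) : Matrix V V ℂ :=
  NormedSpace.exp ((-(Complex.I * (t : ℂ))) • H.map (fun a : ℝ => (a : ℂ)))

/-- The walk generated by a real matrix `M`: the evolution under the Hamiltonian `H = -M`. -/
noncomputable def walkGeneratedBy {V : Type*} [Fintype V] [DecidableEq V]
    (M : Matrix V V ℝ) (t : ℝ) : Matrix V V ℂ :=
  timeEvolution (-M) t

/-- The (peak) transfer fidelity `sup_{t > 0} |U(t)_{u,v}|` between `u` and `v` of a walk `U`. -/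
noncomputable def transferFidelity {V : Type*} (U : ℝ → Matrix V V ℂ) (u v : V) : ℝ :=
  sSup ((fun t : ℝ => ‖U t u v‖) '' Set.Ioi 0)

/-- Two walks agree up to a global phase: at each time they differ by a scalar of modulus one. -/
def EqUpToGlobalPhase {V : Type*} (U W : ℝ → Matrix V V ℂ) : Prop :=
  ∀ t : ℝ, ∃ c : ℂ, ‖c‖ = 1 ∧ U t = c • W t

/-- The number of closed walks of length `l` starting at `x`. -/
noncomputable def closedWalkCount {V : Type*} (G : SimpleGraph V) (x : V) (l : ℕ) : ℕ∞ :=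
  Set.encard {p : G.Walk x x | p.length = l}

/-- The cospectrality `co(u,v)`: the largest `m`, possibly `⊤`, such that for every `l ≤ m` there
are as many closed walks of length `l` at `u` as at `v`. -/
noncomputable def cospectrality {V : Type*} (G : SimpleGraph V) (u v : V) : ℕ∞ :=
  sSup {m : ℕ∞ | ∀ l : ℕ, (l : ℕ∞) ≤ m → closedWalkCount G u l = closedWalkCount G v l}

/-- The evolution under a symmetric Hamiltonian is unitary. -/
theorem timeEvolution_mem_unitaryGroup {V : Type*} [Fintype V] [DecidableEq V]
    {H : Matrix V V ℝ} (hH : H.IsSymm) (t : ℝ) :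
    timeEvolution H t ∈ Matrix.unitaryGroup V ℂ := by
  have hs : ((-(Complex.I * (t : ℂ))) • H.map (fun a : ℝ => (a : ℂ))).conjTranspose
      = -((-(Complex.I * (t : ℂ))) • H.map (fun a : ℝ => (a : ℂ))) := by
    ext i j
    simp [Matrix.conjTranspose_apply, hH.apply i j]
  rw [Matrix.mem_unitaryGroup_iff, Matrix.star_eq_conjTranspose]
  unfold timeEvolution
  rw [← Matrix.exp_conjTranspose, hs]
  generalize (-(Complex.I * (t : ℂ))) • H.map (fun a : ℝ => (a : ℂ)) = X
  rw [← Matrix.exp_add_of_commute X (-X) (Commute.neg_right (Commute.refl X)), add_neg_cancel,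
    NormedSpace.exp_zero]

/-- For a symmetric generator the supremum in `transferFidelity` is a genuine least upper bound. -/
theorem isLUB_transferFidelity {V : Type*} [Fintype V] [DecidableEq V]
    {M : Matrix V V ℝ} (hM : M.IsSymm) (u v : V) :
    IsLUB ((fun t : ℝ => ‖walkGeneratedBy M t u v‖) '' Set.Ioi 0)
      (transferFidelity (walkGeneratedBy M) u v) := by
  refine isLUB_csSup ⟨_, 1, Set.mem_Ioi.2 one_pos, rfl⟩ ⟨1, ?_⟩
  rintro _ ⟨t, -, rfl⟩
  exact entry_norm_bound_of_unitary
    (timeEvolution_mem_unitaryGroup (H := -M) (by simpa [Matrix.IsSymm] using hM) t) u v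

end QuantumWalk

/-! The degrees in $K_{2,m}$, $m = n-2$, are $m$ and $2$, so $L_k = 2kI + A + Q(E_u+E_v)$ with $Q =
k(m-2)$, and the scalar part is only a global phase. Swapping $u$ and $v$ is an automorphism, which
settles cospectrality. The amplitude from $v$ to $u$ is governed by three eigenvalues: $Q$ on $e_u -
e_v$, and the roots $\mu, \nu$ of $z^2 = Qz + 2m$, whose symmetric eigenvectors span $e_u + e_v$. It
equals $(p e^{i\mu t} + (1-p)e^{i\nu t} - e^{iQt})/2$ with $p = \mu/(\mu-\nu) = \mu^2/(\mu^2+2m)$.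
When $e^{i\mu t} = -e^{iQt}$ its modulus is at least $(1+p)/2 - (1-p)/2 = p$
(`div_le_transferFidelity_potentialMatrix`). The root of larger modulus has $\mu^2 \ge Q^2$, so $p
\ge 1-\varepsilon$ once $2m \le \varepsilon Q^2$, which the threshold on $|k|$ guarantees with room
to spare. -/

open Matrix in
/-- The exponential of a matrix acts on an eigenvector by the exponential of the eigenvalue. -/
theorem Matrix.exp_mulVec_of_eigenvector {V : Type*} [Fintype V] [DecidableEq V]
    {X : Matrix V V ℂ} {x : V → ℂ} {z : ℂ} (h : X *ᵥ x = z • x) :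
    NormedSpace.exp X *ᵥ x = Complex.exp z • x := by
  -- Any submultiplicative norm serves for the convergence of the exponential series.
  let : NormedRing (Matrix V V ℂ) := Matrix.linftyOpNormedRing
  let : NormedAlgebra ℂ (Matrix V V ℂ) := Matrix.linftyOpNormedAlgebra
  have hpow : ∀ j : ℕ, X ^ j *ᵥ x = z ^ j • x := by
    intro j
    induction j with
    | zero => simp
    | succ j ih => rw [pow_succ, ← mulVec_mulVec, h, mulVec_smul, ih, smul_smul, pow_succ']
  have hX : HasSum (fun j : ℕ => ((j.factorial : ℂ)⁻¹ • X ^ j) *ᵥ x) (NormedSpace.exp X *ᵥ x) :=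
    (NormedSpace.exp_series_hasSum_exp' (𝕂 := ℂ) X).map
      (AddMonoidHom.mk' (fun Y : Matrix V V ℂ => Y *ᵥ x) fun Y Z => add_mulVec Y Z x)
      (continuous_id.matrix_mulVec continuous_const)
  have hz : HasSum (fun j : ℕ => ((j.factorial : ℂ)⁻¹ • z ^ j) • x) (Complex.exp z • x) := by
    rw [Complex.exp_eq_exp_ℂ]
    exact (NormedSpace.exp_series_hasSum_exp' (𝕂 := ℂ) z).smul_const x
  refine hX.unique (hz.congr_fun ?_)
  intro j
  rw [smul_mulVec, hpow, smul_assoc]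

section QuantumWalk

open Matrix

/-! ### Walks, eigenvectors and global phases -/

section General

variable {V : Type*} [Fintype V] [DecidableEq V]

theorem walkGeneratedBy_eq_exp (M : Matrix V V ℝ) (t : ℝ) :
    walkGeneratedBy M t =
      NormedSpace.exp ((Complex.I * (t : ℂ)) • M.map (fun a : ℝ => (a : ℂ))) := by
  unfold walkGeneratedBy timeEvolution
  congr 1
  ext i j
  simp

theorem walkGeneratedBy_mulVec_of_eigenvector {M : Matrix V V ℝ} {x : V → ℝ} {μ : ℝ}
    (h : M *ᵥ x = μ • x) (t : ℝ) :
    walkGeneratedBy M t *ᵥ (fun i => (x i : ℂ)) =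
      Complex.exp ((μ * t : ℝ) * Complex.I) • fun i => (x i : ℂ) := by
  rw [walkGeneratedBy_eq_exp]
  refine exp_mulVec_of_eigenvector ?_
  ext i
  have hi : ∑ j, M i j * x j = μ * x i := congrFun h i
  have hc : ∑ j, (M i j : ℂ) * (x j : ℂ) = (μ : ℂ) * (x i : ℂ) := by exact_mod_cast hi
  rw [smul_mulVec]
  simp only [Pi.smul_apply, mulVec, dotProduct, map_apply, smul_eq_mul, hc]
  push_cast
  ring

/-- Adding a multiple of the identity to the generator changes the walk by a global phase. -/
theorem walkGeneratedBy_smul_one_add (M : Matrix V V ℝ) (c t : ℝ) :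
    walkGeneratedBy (c • (1 : Matrix V V ℝ) + M) t =
      Complex.exp ((c * t : ℝ) * Complex.I) • walkGeneratedBy M t := by
  have hsplit : (Complex.I * (t : ℂ)) • (c • (1 : Matrix V V ℝ) + M).map (fun a : ℝ => (a : ℂ)) =
      (((c * t : ℝ) : ℂ) * Complex.I) • (1 : Matrix V V ℂ) +
        (Complex.I * (t : ℂ)) • M.map (fun a : ℝ => (a : ℂ)) := by
    ext i j
    by_cases hij : i = j
    · subst hij
      simp only [Matrix.smul_apply, map_apply, Matrix.add_apply, one_apply_eq, smul_eq_mul]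
      push_cast
      ring
    · simp [one_apply_ne hij]
  have hone : NormedSpace.exp ((((c * t : ℝ) : ℂ) * Complex.I) • (1 : Matrix V V ℂ)) =
      Complex.exp ((c * t : ℝ) * Complex.I) • 1 := by
    refine ext_of_mulVec_single fun i => ?_
    rw [exp_mulVec_of_eigenvector (z := ((c * t : ℝ) : ℂ) * Complex.I), smul_mulVec, one_mulVec]
    rw [smul_mulVec, one_mulVec]
  rw [walkGeneratedBy_eq_exp, walkGeneratedBy_eq_exp, hsplit,
    exp_add_of_commute _ _ ((Commute.one_left _).smul_left _), hone, smul_mul_assoc, one_mul]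

theorem eqUpToGlobalPhase_smul_one_add (M : Matrix V V ℝ) (c : ℝ) :
    EqUpToGlobalPhase (walkGeneratedBy (c • (1 : Matrix V V ℝ) + M)) (walkGeneratedBy M) :=
  fun t => ⟨_, Complex.norm_exp_ofReal_mul_I _, walkGeneratedBy_smul_one_add M c t⟩

theorem EqUpToGlobalPhase.transferFidelity_eq {V : Type*} {U W : ℝ → Matrix V V ℂ}
    (h : EqUpToGlobalPhase U W) (u v : V) : transferFidelity U u v = transferFidelity W u v := by
  unfold transferFidelity
  congr 2
  funext t
  obtain ⟨c, hc, ht⟩ := h t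
  rw [ht, Matrix.smul_apply, norm_smul, hc, one_mul]

theorem norm_le_transferFidelity {M : Matrix V V ℝ} (hM : M.IsSymm) (u v : V) {t : ℝ}
    (ht : 0 < t) :
    ‖walkGeneratedBy M t u v‖ ≤ transferFidelity (walkGeneratedBy M) u v :=
  (isLUB_transferFidelity hM u v).1 ⟨t, ht, rfl⟩

end General

/-! ### Closed walks under automorphisms -/

section Cospectrality

variable {V : Type*} {G : SimpleGraph V}

theorem closedWalkCount_le_apply (σ : G ≃g G) (x : V) (l : ℕ) :
    closedWalkCount G x l ≤ closedWalkCount G (σ x) l := by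
  refine Set.encard_le_encard_of_injOn (f := fun p => p.map σ.toHom) ?_ ?_
  · intro p hp
    exact (SimpleGraph.Walk.length_map _ _).trans hp
  · exact (SimpleGraph.Walk.map_injective_of_injective σ.injective x x).injOn

theorem closedWalkCount_apply (σ : G ≃g G) (x : V) (l : ℕ) :
    closedWalkCount G (σ x) l = closedWalkCount G x l := by
  refine le_antisymm ?_ (closedWalkCount_le_apply σ x l)
  simpa using closedWalkCount_le_apply σ.symm (σ x) l

theorem cospectrality_apply_self (σ : G ≃g G) (x : V) : cospectrality G (σ x) x = ⊤ :=
  top_le_iff.1 (le_sSup fun l _ => closedWalkCount_apply σ x l)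

end Cospectrality

/-! ### Spectrum and transfer fidelity of $K_{2,m}$ -/

section CompleteBipartite

variable {m : ℕ}

theorem completeBipartiteGraph_degree_inl (u : Fin 2) :
    (completeBipartiteGraph (Fin 2) (Fin m)).degree (Sum.inl u) = m := by
  rw [← SimpleGraph.card_neighborFinset_eq_degree, SimpleGraph.neighborFinset_eq_filter,
    Finset.univ_disjSum_univ.symm, Finset.card_filter, Finset.sum_disjSum]
  simp

theorem completeBipartiteGraph_degree_inr (w : Fin m) :
    (completeBipartiteGraph (Fin 2) (Fin m)).degree (Sum.inr w) = 2 := by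
  rw [← SimpleGraph.card_neighborFinset_eq_degree, SimpleGraph.neighborFinset_eq_filter,
    Finset.univ_disjSum_univ.symm, Finset.card_filter, Finset.sum_disjSum]
  simp

/-- The involution of `K_{2,m}` that interchanges the vertices `u` and `v`. -/
def completeBipartiteSwap (m : ℕ) (u v : Fin 2) :
    completeBipartiteGraph (Fin 2) (Fin m) ≃g completeBipartiteGraph (Fin 2) (Fin m) :=
  SimpleGraph.completeBipartiteGraphCongr (Equiv.swap u v) (Equiv.refl _)

theorem completeBipartiteSwap_inl (u v x : Fin 2) :
    completeBipartiteSwap m u v (Sum.inl x) = Sum.inl (Equiv.swap u v x) := rfl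

theorem completeBipartiteSwap_inr (u v : Fin 2) (w : Fin m) :
    completeBipartiteSwap m u v (Sum.inr w) = Sum.inr w := rfl

theorem completeBipartiteSwap_involutive (u v : Fin 2) :
    Function.Involutive (completeBipartiteSwap m u v) := by
  rintro (x | w)
  · simp [completeBipartiteSwap_inl]
  · simp [completeBipartiteSwap_inr]

/-- The adjacency matrix of `K_{2,m}` with the potential `Q` on the part of size two. -/
noncomputable def potentialMatrix (m : ℕ) (u v : Fin 2) (Q : ℝ) :
    Matrix (Fin 2 ⊕ Fin m) (Fin 2 ⊕ Fin m) ℝ :=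
  (completeBipartiteGraph (Fin 2) (Fin m)).adjMatrix ℝ +
    Q • (vertexProjection (Sum.inl u) + vertexProjection (Sum.inl v))

/-- As $u \ne v$ exhaust the small part, $E_u + E_v$ is the identity there. -/
theorem potentialMatrix_eq_fromBlocks {u v : Fin 2} (huv : u ≠ v) (Q : ℝ) :
    potentialMatrix m u v Q =
      fromBlocks (Q • (1 : Matrix (Fin 2) (Fin 2) ℝ)) (of fun _ _ => 1) (of fun _ _ => 1) 0 := by
  ext (i | i) (j | j)
  · fin_cases u <;> fin_cases v <;> fin_cases i <;> fin_cases j <;>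
      simp [potentialMatrix, vertexProjection, vecMulVec_apply] at huv ⊢
  all_goals simp [potentialMatrix, vertexProjection, vecMulVec_apply, Pi.single_apply]

theorem generalizedLaplacian_eq_smul_one_add {u v : Fin 2} (huv : u ≠ v) (k : ℝ) :
    generalizedLaplacian (completeBipartiteGraph (Fin 2) (Fin m)) k =
      (2 * k) • (1 : Matrix (Fin 2 ⊕ Fin m) (Fin 2 ⊕ Fin m) ℝ) +
        potentialMatrix m u v (k * ((m : ℝ) - 2)) := by
  rw [potentialMatrix_eq_fromBlocks huv]
  ext (i | i) (j | j)
  · by_cases hij : i = j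
    · subst hij
      simp [generalizedLaplacian, SimpleGraph.degMatrix, completeBipartiteGraph_degree_inl]
      ring
    · simp [generalizedLaplacian, SimpleGraph.degMatrix, one_apply_ne, hij]
  · simp [generalizedLaplacian, SimpleGraph.degMatrix]
  · simp [generalizedLaplacian, SimpleGraph.degMatrix]
  · by_cases hij : i = j
    · subst hij
      simp [generalizedLaplacian, SimpleGraph.degMatrix, completeBipartiteGraph_degree_inr]
      ring
    · simp [generalizedLaplacian, SimpleGraph.degMatrix, one_apply_ne, hij]

theorem potentialMatrix_isSymm {u v : Fin 2} (huv : u ≠ v) (Q : ℝ) :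
    (potentialMatrix m u v Q).IsSymm := by
  rw [potentialMatrix_eq_fromBlocks huv, isSymm_fromBlocks_iff]
  exact ⟨by simp [IsSymm], by ext; rfl, by ext; rfl, by simp [IsSymm]⟩

/-- For a vector constant on each part, the large part forces the ratio $\mu : 2$ and the small part
then gives the quadratic. The value $2$ is independent of $\mu$, so the eigenvectors of two roots
differ by a multiple of $e_u + e_v$. -/
theorem potentialMatrix_mulVec_symmetric {u v : Fin 2} (huv : u ≠ v) {Q μ : ℝ}
    (hμ : μ ^ 2 = Q * μ + 2 * m) :
    potentialMatrix m u v Q *ᵥ Sum.elim (fun _ => μ) (fun _ => 2) =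
      μ • Sum.elim (fun _ => μ) (fun _ => 2) := by
  rw [potentialMatrix_eq_fromBlocks huv, fromBlocks_mulVec]
  ext (i | i)
  · simp [smul_mulVec, mulVec, dotProduct]
    linarith
  · simp [mulVec, dotProduct]
    ring

theorem potentialMatrix_mulVec_antisymmetric {u v : Fin 2} (huv : u ≠ v) (Q : ℝ) :
    potentialMatrix m u v Q *ᵥ (Pi.single (Sum.inl u) 1 - Pi.single (Sum.inl v) 1) =
      Q • (Pi.single (Sum.inl u) 1 - Pi.single (Sum.inl v) 1) := by
  rw [potentialMatrix_eq_fromBlocks huv, mulVec_sub, mulVec_single_one, mulVec_single_one]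
  ext (i | i)
  · simp [Pi.single_apply, one_apply, mul_sub]
  · simp

/-- The transfer amplitude between the two vertices of the part of size two. -/
theorem walkGeneratedBy_potentialMatrix_apply {u v : Fin 2} (huv : u ≠ v) {Q μ ν : ℝ}
    (hμ : μ ^ 2 = Q * μ + 2 * m) (hν : ν ^ 2 = Q * ν + 2 * m) (hne : μ ≠ ν) (t : ℝ) :
    walkGeneratedBy (potentialMatrix m u v Q) t (Sum.inl u) (Sum.inl v) =
      ((μ * Complex.exp ((μ * t : ℝ) * Complex.I) - ν * Complex.exp ((ν * t : ℝ) * Complex.I)) /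
          (μ - ν) - Complex.exp ((Q * t : ℝ) * Complex.I)) / 2 := by
  have hsub : (μ : ℂ) - ν ≠ 0 := by exact_mod_cast sub_ne_zero.2 hne
  have h1 := walkGeneratedBy_mulVec_of_eigenvector (potentialMatrix_mulVec_symmetric huv hμ) t
  have h2 := walkGeneratedBy_mulVec_of_eigenvector (potentialMatrix_mulVec_symmetric huv hν) t
  have h3 := walkGeneratedBy_mulVec_of_eigenvector
    (potentialMatrix_mulVec_antisymmetric (m := m) huv Q) t
  have hpair : ∀ f : Fin 2 → ℂ, ∑ i, f i = f u + f v := by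
    intro f
    fin_cases u <;> fin_cases v <;> simp [add_comm] at huv ⊢
  replace h1 := congrFun h1 (Sum.inl u)
  replace h2 := congrFun h2 (Sum.inl u)
  replace h3 := congrFun h3 (Sum.inl u)
  simp only [mulVec, dotProduct, Fintype.sum_sum_type, hpair, Sum.elim_inl, Sum.elim_inr,
    Pi.smul_apply, smul_eq_mul, Pi.sub_apply, Pi.single_apply, Sum.inl.injEq, huv, huv.symm,
    reduceCtorEq, if_true, if_false, sub_zero, sub_self, zero_sub, Complex.ofReal_zero,
    Complex.ofReal_one, Complex.ofReal_neg, mul_zero, Finset.sum_const_zero, add_zero] at h1 h2 h3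
  generalize Complex.exp ((μ * t : ℝ) * Complex.I) = a at *
  generalize Complex.exp ((ν * t : ℝ) * Complex.I) = b at *
  generalize Complex.exp ((Q * t : ℝ) * Complex.I) = c at *
  field_simp
  -- `h1 - h2` cancels the large part, leaving $(\mu-\nu)(U_{uu}+U_{uv})$; `h3` gives
  -- $U_{uu}-U_{uv}$.
  linear_combination h1 - h2 - ((μ : ℂ) - ν) * h3

/-- If `μ` is the dominant symmetric eigenvalue, the fidelity is at least its weight. -/
theorem div_le_transferFidelity_potentialMatrix {u v : Fin 2} (huv : u ≠ v) (hm : 0 < m) {Q μ : ℝ}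
    (hμ : μ ^ 2 = Q * μ + 2 * m) (hμ0 : μ ≠ 0) :
    μ ^ 2 / (μ ^ 2 + 2 * m) ≤
      transferFidelity (walkGeneratedBy (potentialMatrix m u v Q)) (Sum.inl u) (Sum.inl v) := by
  have hm' : (0 : ℝ) < m := by exact_mod_cast hm
  have hμQ : μ - Q = 2 * m / μ := by
    field_simp
    linarith
  have hμQ0 : μ - Q ≠ 0 := by
    rw [hμQ]
    positivity
  -- The other root, by Vieta.
  set ν := Q - μ with hν
  have hprod : μ * ν = -(2 * m) := by
    rw [hν]
    linarith
  have hν2 : ν ^ 2 = Q * ν + 2 * m := by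
    rw [hν]
    linarith
  have hden : 0 < μ ^ 2 + 2 * m := by positivity
  have hmul : μ * (μ - ν) = μ ^ 2 + 2 * m := by linarith
  have hne : μ - ν ≠ 0 := by
    intro h
    rw [h] at hmul
    linarith
  set p := μ ^ 2 / (μ ^ 2 + 2 * m) with hp
  have hp' : p = μ / (μ - ν) := by
    rw [hp, ← hmul]
    field_simp
  have hp0 : 0 ≤ p := by positivity
  have hp1 : p ≤ 1 := (div_le_one hden).2 (by linarith)
  -- At this time the phases of $\mu$ and $Q$ are opposite, whatever the sign of $\mu - Q$.
  set t := Real.pi / |μ - Q| with ht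
  have htpos : 0 < t := div_pos Real.pi_pos (abs_pos.2 hμQ0)
  refine le_trans ?_ (norm_le_transferFidelity (potentialMatrix_isSymm huv Q) _ _ htpos)
  have hphase : Complex.exp ((μ * t : ℝ) * Complex.I) =
      -Complex.exp ((Q * t : ℝ) * Complex.I) := by
    have hsplit : (((μ * t : ℝ) : ℂ) * Complex.I) =
        ((Q * t : ℝ) : ℂ) * Complex.I + (((μ - Q) * t : ℝ) : ℂ) * Complex.I := by
      push_cast
      ring
    rw [hsplit, Complex.exp_add]
    rcases abs_cases (μ - Q) with ⟨h, _⟩ | ⟨h, _⟩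
    · have : (μ - Q) * t = Real.pi := by
        rw [ht, h]
        field_simp
      rw [this, Complex.exp_pi_mul_I]
      ring
    · have : (μ - Q) * t = -Real.pi := by
        rw [ht, h]
        field_simp
      rw [this, Complex.ofReal_neg, neg_mul, Complex.exp_neg_pi_mul_I]
      ring
  have hamp : walkGeneratedBy (potentialMatrix m u v Q) t (Sum.inl u) (Sum.inl v) =
      ((1 - p) / 2 : ℝ) * Complex.exp ((ν * t : ℝ) * Complex.I) -
        ((1 + p) / 2 : ℝ) * Complex.exp ((Q * t : ℝ) * Complex.I) := by
    have hc : (μ : ℂ) - ν ≠ 0 := by exact_mod_cast hne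
    rw [walkGeneratedBy_potentialMatrix_apply huv hμ hν2 (sub_ne_zero.1 hne), hphase, hp']
    push_cast
    field_simp
    ring
  rw [hamp, norm_sub_rev]
  refine le_trans ?_ (norm_sub_norm_le _ _)
  rw [norm_mul, norm_mul, Complex.norm_exp_ofReal_mul_I, Complex.norm_exp_ofReal_mul_I,
    Complex.norm_real, Complex.norm_real, Real.norm_eq_abs, Real.norm_eq_abs,
    abs_of_nonneg (by linarith), abs_of_nonneg (by linarith)]
  linarith

/-- Giving the square root the sign of $Q$ avoids cancellation; negative $Q$ must be covered because
$k$ may be negative. -/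
theorem exists_root_sq_le {Q c : ℝ} (hc : 0 ≤ c) : ∃ μ : ℝ, μ ^ 2 = Q * μ + c ∧ Q ^ 2 ≤ μ ^ 2 := by
  have hs : 0 ≤ Q ^ 2 + 4 * c := by positivity
  have hsq := Real.sq_sqrt hs
  have hle : |Q| ≤ √(Q ^ 2 + 4 * c) := Real.abs_le_sqrt (by linarith)
  rcases abs_cases Q with ⟨h, h0⟩ | ⟨h, h0⟩ <;> rw [h] at hle
  · exact ⟨(Q + √(Q ^ 2 + 4 * c)) / 2, by nlinarith, by gcongr; linarith⟩
  · exact ⟨(Q - √(Q ^ 2 + 4 * c)) / 2, by nlinarith, by nlinarith⟩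

theorem one_sub_le_transferFidelity_potentialMatrix {u v : Fin 2} (huv : u ≠ v) (hm : 0 < m)
    {Q ε : ℝ} (hε : 0 ≤ ε) (hQ0 : Q ≠ 0) (hQ : 2 * m ≤ ε * Q ^ 2) :
    1 - ε ≤
      transferFidelity (walkGeneratedBy (potentialMatrix m u v Q)) (Sum.inl u) (Sum.inl v) := by
  obtain ⟨μ, hμ, hle⟩ := exists_root_sq_le (Q := Q) (c := 2 * m) (by positivity)
  have hQpos : 0 < Q ^ 2 := by positivity
  have hμ0 : μ ≠ 0 := by
    rintro rfl
    linarith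
  refine le_trans ?_ (div_le_transferFidelity_potentialMatrix huv hm hμ hμ0)
  have hden : 0 < μ ^ 2 + 2 * (m : ℝ) := by positivity
  rw [le_div_iff₀ hden]
  have h1 : ε * Q ^ 2 ≤ ε * μ ^ 2 := by gcongr
  have h2 : 0 ≤ ε * (2 * m) := by positivity
  linarith

theorem two_mul_le_of_threshold_lt_abs {x k ε : ℝ} (hx : 2 < x) (hε : 0 < ε)
    (h : 16 * (x ^ ((3 : ℝ) / 2) / (√ε * (x - 2))) < |k|) :
    2 * x ≤ ε * (k * (x - 2)) ^ 2 := by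
  have hx0 : 0 < x := by linarith
  have hx2 : 0 < x - 2 := by linarith
  have hs : 0 < √ε := Real.sqrt_pos.2 hε
  have h' : 16 * x ^ ((3 : ℝ) / 2) < |k| * (√ε * (x - 2)) := by
    rwa [← mul_div_assoc, div_lt_iff₀ (by positivity)] at h
  have hsq : (16 * x ^ ((3 : ℝ) / 2)) ^ 2 ≤ (|k| * (√ε * (x - 2))) ^ 2 := by gcongr
  have hpow : (x ^ ((3 : ℝ) / 2)) ^ 2 = x ^ 3 := by
    rw [← Real.rpow_natCast, ← Real.rpow_mul hx0.le, ← Real.rpow_natCast]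
    norm_num
  rw [mul_pow, hpow, mul_pow, mul_pow, sq_abs, Real.sq_sqrt hε.le] at hsq
  -- The squared threshold reads $256x^3 \le \varepsilon k^2(x-2)^2$, far more than the $2x$
  -- required.
  have hcube : x ≤ x ^ 3 := le_self_pow₀ (by linarith) (by norm_num)
  linarith

end CompleteBipartite

end QuantumWalk

theorem mainTheorem3 (n : ℕ) (hn : 5 ≤ n) (u v : Fin 2) (huv : u ≠ v) :
    -- the vertices `u`, `v` of the part of size two have degree `n - 2`, all others degree two
    ((completeBipartiteGraph (Fin 2) (Fin (n - 2))).degree (Sum.inl u) = n - 2 ∧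
      (completeBipartiteGraph (Fin 2) (Fin (n - 2))).degree (Sum.inl v) = n - 2 ∧
      ∀ w : Fin (n - 2), (completeBipartiteGraph (Fin 2) (Fin (n - 2))).degree (Sum.inr w) = 2) ∧
    -- some involution of the graph interchanges `u` and `v`
    (∃ σ : completeBipartiteGraph (Fin 2) (Fin (n - 2)) ≃g
        completeBipartiteGraph (Fin 2) (Fin (n - 2)),
      Function.Involutive σ ∧ σ (Sum.inl v) = Sum.inl u) ∧
    -- `u` and `v` have infinite cospectrality
    cospectrality (completeBipartiteGraph (Fin 2) (Fin (n - 2))) (Sum.inl u) (Sum.inl v) = ⊤ ∧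
    -- up to a global phase, `L_k` and `A + Q (E_u + E_v)`, `Q = k (n - 4)`, generate the same walk
    (∀ k : ℝ, EqUpToGlobalPhase
      (walkGeneratedBy (generalizedLaplacian (completeBipartiteGraph (Fin 2) (Fin (n - 2))) k))
      (walkGeneratedBy ((completeBipartiteGraph (Fin 2) (Fin (n - 2))).adjMatrix ℝ +
        (k * ((n : ℝ) - 4)) •
          (vertexProjection (Sum.inl u) + vertexProjection (Sum.inl v))))) ∧
    -- the bound on `|k|` guarantees transfer fidelity at least `1 - ε`
    (∀ k ε : ℝ, 0 < ε →
      16 * (((n : ℝ) - 2) ^ ((3 : ℝ) / 2) / (Real.sqrt ε * ((n : ℝ) - 4))) < |k| →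
      1 - ε ≤ transferFidelity
        (walkGeneratedBy (generalizedLaplacian (completeBipartiteGraph (Fin 2) (Fin (n - 2))) k))
        (Sum.inl u) (Sum.inl v)) := by
  obtain ⟨m, rfl⟩ : ∃ m, n = m + 2 := ⟨n - 2, by omega⟩
  rw [Nat.add_sub_cancel]
  have hcast : ((m + 2 : ℕ) : ℝ) - 4 = (m : ℝ) - 2 := by
    push_cast
    ring
  have hcast' : ((m + 2 : ℕ) : ℝ) - 2 = (m : ℝ) := by
    push_cast
    ring
  -- This is where $n \ge 5$ enters: at $m = 2$ the graph is regular and $Q$ vanishes for every $k$.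
  have hm : (2 : ℝ) < m := by exact_mod_cast (by omega : 2 < m)
  have hswap : completeBipartiteSwap m u v (Sum.inl v) = Sum.inl u := by
    simp [completeBipartiteSwap_inl]
  have hphase : ∀ k : ℝ, EqUpToGlobalPhase
      (walkGeneratedBy (generalizedLaplacian (completeBipartiteGraph (Fin 2) (Fin m)) k))
      (walkGeneratedBy (potentialMatrix m u v (k * ((m : ℝ) - 2)))) := by
    intro k
    rw [generalizedLaplacian_eq_smul_one_add huv]
    exact eqUpToGlobalPhase_smul_one_add _ _
  refine ⟨⟨completeBipartiteGraph_degree_inl u, completeBipartiteGraph_degree_inl v,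
    completeBipartiteGraph_degree_inr⟩,
    ⟨completeBipartiteSwap m u v, completeBipartiteSwap_involutive u v, hswap⟩, ?_, ?_, ?_⟩
  · rw [← hswap]
    exact cospectrality_apply_self _ _
  · rw [hcast]
    exact hphase
  · intro k ε hε h
    rw [hcast, hcast'] at h
    have hbound := two_mul_le_of_threshold_lt_abs hm hε h
    rw [(hphase k).transferFidelity_eq]
    refine one_sub_le_transferFidelity_potentialMatrix huv (by omega) hε.le ?_ hbound
    intro h0
    rw [h0] at hbound
    linarith
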